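/- Let $S_n$ be the symmetric group on $\{1,\dots,n\}$ and $\mathbb F_r$ the free group on $x_1,\dots,x_r$. Every $w\in S_n*\mathbb F_r$ has a unique reduced expression $w=c_0x_{\iota(1)}^{\varepsilon(1)}c_1\cdots x_{\iota(l)}^{\varepsilon(l)}c_l$ with $c_j\in S_n$, $\varepsilon(j)\in\{\pm1\}$. Here a constant $c_j$ with $1\le j\le l-1$, $\iota(j)=\iota(j+1)$ and $\varepsilon(j)=-\varepsilon(j+1)$ is called critical, and reduced means that no critical constant is trivial. The number $l$ is the length of $w$. The critical constants of an element are those of its reduced expression. Call $w$ regular if $w$ is not conjugate in $S_n*\mathbb F_r$ to an element of $S_n$ and every critical constant of $w^2$ is fixed point free. For $\sigma=(\sigma_1,\dots,\sigma_r)\in S_n^r$ let $w(\sigma)\in S_n$ be obtained by substituting $\sigma_i$ for $x_i$. For $\tau\in S_n$ and $h>0$ let $f_{\le h}(\tau)$ be the number of points of $\{1,\dots,n\}$ that lie in cycles of $\tau$ of length at most $h$ (fixed points being cycles of length $1$). **Proposition 2.3.** There exists a constant $c>0$ such that the following holds for all real $f\ge 0$ and $h>0$, all integers $n,r\ge 0$,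 and every regular $w\in S_n*\mathbb F_r$ of length $l<c f^{1/2}/h$. If $\sigma$ is uniformly distributed on $S_n^r$, then $$\mathbb P\bigl(f_{\le h}(w(\sigma))\ge f\bigr)\le \exp\left(-\frac{c f}{(lh)^2}\right).$$ -/

import Mathlib

open Monoid

/-- An expression `c₀ x_{ι(1)}^{ε(1)} c₁ ⋯ x_{ι(l)}^{ε(l)} c_l` with constants `c₀, …, c_l` in `G` and
variables `x_i`, `i : Fin r`. The field `first` is `c₀` and the `j`-th entry of `syllables` is
`((ι(j), ε(j)), c_j)`, where `ε(j) = true` stands for the exponent `1` and `false` for `-1`. -/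
structure ConstWord (G : Type*) (r : ℕ) where
  first : G
  syllables : List ((Fin r × Bool) × G)

namespace ConstWord

variable {G : Type*} {r : ℕ}

/-- The length `l`: the number of occurrences of variables. -/
def length (w : ConstWord G r) : ℕ := w.syllables.length

/-- The critical constants: those `c_j`, `1 ≤ j ≤ l - 1`, that occur as `x_i c_j x_i⁻¹` or
`x_i⁻¹ c_j x_i`. -/
def criticalConstants (w : ConstWord G r) : Set G :=
  {c | ∃ (i : Fin r) (e : Bool) (d : G) (p s : List ((Fin r × Bool) × G)),
    w.syllables = p ++ ((i, e), c) :: ((i, !e), d) :: s}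

variable [Group G]

/-- The letter `x_i` or `x_i⁻¹` of the free group. -/
def letter (a : Fin r × Bool) : FreeGroup (Fin r) :=
  if a.2 then FreeGroup.of a.1 else (FreeGroup.of a.1)⁻¹

/-- The element of the free product `G ∗ F_r` that the expression represents. -/
def toCoprod (w : ConstWord G r) : Coprod G (FreeGroup (Fin r)) :=
  Coprod.inl w.first *
    (w.syllables.map fun a => Coprod.inr (letter a.1) * Coprod.inl a.2).prod

/-- An expression is reduced if no critical constant is trivial. By the normal form theorem for free
products, each element of `G ∗ F_r` is represented by exactly one reduced expression. -/
def IsReduced (w : ConstWord G r) : Prop := ∀ c ∈ w.criticalConstants, c ≠ 1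

end ConstWord

/-- `w(g₁, …, g_r)`: the image of `w` under the homomorphism `G ∗ F_r → G` that is the identity on
`G` and sends `x_i` to `g_i`. -/
def wordMap {G : Type*} [Group G] {r : ℕ} (w : Coprod G (FreeGroup (Fin r))) (g : Fin r → G) : G :=
  Coprod.lift (MonoidHom.id G) (FreeGroup.lift g) w

/-- `w ∈ S_n ∗ F_r` is regular if it is not conjugate to an element of `S_n` and the critical
constants of (the reduced expression of) `w²` are fixed point free. -/
def IsRegularWord {n r : ℕ} (w : Coprod (Equiv.Perm (Fin n)) (FreeGroup (Fin r))) : Prop :=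
  (¬ ∃ g : Equiv.Perm (Fin n), IsConj w (Coprod.inl g)) ∧
    ∀ v : ConstWord (Equiv.Perm (Fin n)) r, v.IsReduced → v.toCoprod = w ^ 2 →
      ∀ c ∈ v.criticalConstants, ∀ x : Fin n, c x ≠ x

/-- `F_i(σ)`: the points lying in an `i`-cycle of `σ` (fixed points form `1`-cycles). -/
def cyclePoints {n : ℕ} (σ : Equiv.Perm (Fin n)) (i : ℕ) : Set (Fin n) :=
  {x | Function.minimalPeriod σ x = i}

/-- `F_{≤ h}(σ)`: the points lying in cycles of `σ` of length at most `h`. -/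
def shortCyclePoints {n : ℕ} (σ : Equiv.Perm (Fin n)) (h : ℝ) : Set (Fin n) :=
  {x | ∃ i : ℕ, 1 ≤ i ∧ (i : ℝ) ≤ h ∧ x ∈ cyclePoints σ i}

/-- The normalized counting measure of a subset of a finite type. -/
noncomputable def uniformProb {α : Type*} [Finite α] (A : Set α) : ℝ :=
  (A.ncard : ℝ) / (Nat.card α : ℝ)

/-! The proof is Markov's inequality for a count of k-tuples of points, with σ revealed one value at
a time. Pass to a cyclically reduced conjugate of w (`exists_cyclic_core`) and write its inverse,
repeated ⌊h⌋ times, as a list of T ≤ lh steps. Followed from a point of a short cycle, this list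
returns to that point. So if f points lie in short cycles, there are at least (f - 2m)^k ways to
choose k successive untouched starting points whose walks all run into a point already seen; here m
= kT bounds the number of revealed values (`pow_le_countSeq`).

For random σ, a letter at a fresh point takes each value with conditional probability at most 1/(n -
m) (`card_consistent_cons_mul_le`), so a step hits a seen point with probability at most β = (2m +
1)/(n - m). Regularity keeps every queried value fresh: after a step to an unseen point, the next
value could be known only if the next letter inverts the last one and the constant between them
fixes a point. Hence the count has mean at most (nTβ)^k (`sum_walk_le`, `sum_countSeq_le`), and k ≈
f/(24(lh)²) makes the quotient at most e^(-k). -/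

section Exposure

open Finset Equiv

variable {ι α : Type*}

/-! ### Revealed values and walks -/

/-- The inverse of a letter. -/
def invLetter (a : ι × Bool) : ι × Bool := (a.1, !a.2)

@[simp] lemma invLetter_invLetter (a : ι × Bool) : invLetter (invLetter a) = a := by
  simp [invLetter]

lemma invLetter_ne (a : ι × Bool) : invLetter a ≠ a := by
  intro h
  have := congrArg Prod.snd h
  simp [invLetter] at this

/-- The value of the letter `x_i` or `x_i⁻¹` at a tuple. -/
def evalLetter {G : Type*} [Group G] (σ : ι → G) (a : ι × Bool) : G :=
  if a.2 then σ a.1 else (σ a.1)⁻¹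

@[simp] lemma evalLetter_invLetter {G : Type*} [Group G] (σ : ι → G) (a : ι × Bool) :
    evalLetter σ (invLetter a) = (evalLetter σ a)⁻¹ := by
  rcases a with ⟨i, _ | _⟩ <;> simp [evalLetter, invLetter]

/-- The points occurring in a list of revealed values `(a, y, b)`, which say that the letter `a`
sends `y` to `b`. -/
def touched [DecidableEq α] (K : List ((ι × Bool) × α × α)) : Finset α :=
  (K.flatMap fun q => [q.2.1, q.2.2]).toFinset

/-- The value of the letter `a` at `y` is not among the revealed ones. -/
def Fresh (K : List ((ι × Bool) × α × α)) (a : ι × Bool) (y : α) : Prop :=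
  ∀ q ∈ K, (q.1 = a → q.2.1 ≠ y) ∧ (q.1 = invLetter a → q.2.2 ≠ y)

/-- The point reached from `y` by applying the steps `(a, d)` of a list: first the letter `a`, then
the constant `d`. -/
def position (σ : ι → Perm α) : List ((ι × Bool) × Perm α) → α → α
  | [], y => y
  | s :: L, y => position σ L (s.2 (evalLetter σ s.1 y))

lemma position_append (σ : ι → Perm α) (L M : List ((ι × Bool) × Perm α)) (y : α) :
    position σ (L ++ M) y = position σ M (position σ L y) := by
  induction L generalizing y with
  | nil => rfl
  | cons s L ih => exact ih _

lemma eq_or_eq_invLetter {a c : ι × Bool} (h : c.1 = a.1) : c = a ∨ c = invLetter a := by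
  rcases a with ⟨i, _ | _⟩ <;> rcases c with ⟨j, _ | _⟩ <;> simp_all [invLetter]

/-- If a letter `a` with the constant `d` is followed by the inverse of `a`, then `d` is fixed point
free. -/
def NoBacktrack (s t : (ι × Bool) × Perm α) : Prop :=
  t.1 = invLetter s.1 → ∀ x, s.2 x ≠ x

variable [DecidableEq α]

lemma card_touched_le (K : List ((ι × Bool) × α × α)) : #(touched K) ≤ 2 * K.length := by
  refine (List.toFinset_card_le _).trans ?_
  simp [List.length_flatMap, mul_comm]

lemma touched_cons (q : (ι × Bool) × α × α) (K : List ((ι × Bool) × α × α)) :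
    touched (q :: K) = insert q.2.1 (insert q.2.2 (touched K)) := by
  simp [touched]

lemma mem_touched {K : List ((ι × Bool) × α × α)} {y : α} :
    y ∈ touched K ↔ ∃ q ∈ K, y = q.2.1 ∨ y = q.2.2 := by
  simp [touched]

lemma fresh_of_notMem_touched {K : List ((ι × Bool) × α × α)} {y : α} (h : y ∉ touched K)
    (a : ι × Bool) : Fresh K a y := by
  intro q hq
  exact ⟨fun _ e => h (mem_touched.2 ⟨q, hq, Or.inl e.symm⟩),
    fun _ e => h (mem_touched.2 ⟨q, hq, Or.inr e.symm⟩)⟩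

/-- Follow the steps `(a, d)` of a list from the point `y`, revealing values of the letters, until
the current point coincides with an earlier one. Then return `Φ` of the revealed values. -/
def walk (Φ : List ((ι × Bool) × α × α) → (ι → Perm α) → ℝ) (σ : ι → Perm α) :
    List ((ι × Bool) × Perm α) → List ((ι × Bool) × α × α) → α → ℝ
  | [], _, _ => 0
  | s :: L, K, y =>
    if s.2 (evalLetter σ s.1 y) ∈ insert y (touched K) then
      Φ ((s.1, y, evalLetter σ s.1 y) :: K) σ
    else walk Φ σ L ((s.1, y, evalLetter σ s.1 y) :: K) (s.2 (evalLetter σ s.1 y))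

/-- If the walk returns to its start or to a point seen before, it ends in a coincidence. -/
lemma le_walk {Φ : List ((ι × Bool) × α × α) → (ι → Perm α) → ℝ} {σ : ι → Perm α} {B : ℝ}
    (L M : List ((ι × Bool) × Perm α)) (hL : L ≠ []) (K : List ((ι × Bool) × α × α)) (y : α)
    (hy : position σ L y ∈ insert y (touched K))
    (hB : ∀ K', K'.length ≤ K.length + L.length → B ≤ Φ K' σ) :
    B ≤ walk Φ σ (L ++ M) K y := by
  induction L generalizing K y with
  | nil => exact absurd rfl hL
  | cons s L ih =>
    rw [List.cons_append, walk]
    split_ifs with h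
    · exact hB _ (by simp)
    · rcases eq_or_ne L [] with rfl | hne
      · exact absurd hy h
      · refine ih hne _ _ ?_ fun K' hK' => hB K' (by simp at hK' ⊢; omega)
        -- The set of targets only grows: the old start y is now touched.
        rw [position] at hy
        rw [touched_cons]
        simp only [mem_insert] at hy ⊢
        tauto

lemma walk_nonneg {Φ : List ((ι × Bool) × α × α) → (ι → Perm α) → ℝ} {σ : ι → Perm α}
    (hΦ : ∀ K, 0 ≤ Φ K σ) (L : List ((ι × Bool) × Perm α)) (K : List ((ι × Bool) × α × α))
    (y : α) : 0 ≤ walk Φ σ L K y := by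
  induction L generalizing K y with
  | nil => exact le_rfl
  | cons s L ih =>
    rw [walk]
    split_ifs
    · exact hΦ _
    · exact ih _ _

/-! ### Counting coincidences: lower bound for a fixed tuple -/

section Count

variable [Fintype α]

/-- The number of sequences of `k` points each of which leads to a coincidence with the points seen
so far. -/
def countSeq (L : List ((ι × Bool) × Perm α)) :
    ℕ → List ((ι × Bool) × α × α) → (ι → Perm α) → ℝ
  | 0, _, _ => 1
  | k + 1, K, σ => ∑ y ∈ (touched K)ᶜ, walk (countSeq L k) σ L K y

lemma countSeq_nonneg (L : List ((ι × Bool) × Perm α)) (k : ℕ) (K : List ((ι × Bool) × α × α))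
    (σ : ι → Perm α) : 0 ≤ countSeq L k K σ := by
  induction k generalizing K with
  | zero => exact zero_le_one
  | succ k ih => exact sum_nonneg fun y _ => walk_nonneg ih _ _ _

/-- A walk from a point of S stops at the latest when it returns to its start. At most 2m points of
S are ever touched, so each of the k rounds offers at least f - 2m good starts. -/
lemma pow_le_countSeq {L : List ((ι × Bool) × Perm α)} {σ : ι → Perm α} {m : ℕ} {f : ℝ}
    (hf : 2 * m ≤ f) (S : Finset α) (hSf : f ≤ #S)
    (hS : ∀ y ∈ S, ∃ L₁ L₂, L = L₁ ++ L₂ ∧ L₁ ≠ [] ∧ position σ L₁ y = y) (k : ℕ)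
    (K : List ((ι × Bool) × α × α)) (hK : K.length + k * L.length ≤ m) :
    (f - 2 * m) ^ k ≤ countSeq L k K σ := by
  induction k generalizing K with
  | zero => simp [countSeq]
  | succ k ih =>
    rw [Nat.succ_mul] at hK
    have hstep : ∀ y ∈ S \ touched K, (f - 2 * m) ^ k ≤ walk (countSeq L k) σ L K y := by
      intro y hy
      obtain ⟨L₁, L₂, e, hne, hpos⟩ := hS y (mem_sdiff.1 hy).1
      have hlen := congrArg List.length e
      rw [List.length_append] at hlen
      have := le_walk (Φ := countSeq L k) (B := (f - 2 * m) ^ k) (σ := σ) L₁ L₂ hne K y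
        (by rw [hpos]; exact mem_insert_self _ _) fun K' hK' => ih K' (by omega)
      rwa [← e] at this
    have hcard : f - 2 * m ≤ #(S \ touched K) := by
      have h1 : #S ≤ #(S \ touched K) + #(touched K) := by
        have := le_card_sdiff (touched K) S
        omega
      have h2 := card_touched_le K
      have h3 : #S ≤ #(S \ touched K) + 2 * m := by omega
      have : (#S : ℝ) ≤ #(S \ touched K) + 2 * m := by exact_mod_cast h3
      linarith
    have h0 : (0 : ℝ) ≤ f - 2 * m := by linarith
    calc (f - 2 * m) ^ (k + 1) = (f - 2 * m) * (f - 2 * m) ^ k := by ring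
      _ ≤ #(S \ touched K) * (f - 2 * m) ^ k := by gcongr
      _ = ∑ y ∈ S \ touched K, (f - 2 * m) ^ k := by simp
      _ ≤ ∑ y ∈ S \ touched K, walk (countSeq L k) σ L K y := sum_le_sum hstep
      _ ≤ ∑ y ∈ (touched K)ᶜ, walk (countSeq L k) σ L K y :=
          sum_le_sum_of_subset_of_nonneg (fun y hy => by
            rw [mem_compl]; exact (mem_sdiff.1 hy).2) fun y _ _ =>
            walk_nonneg (fun K => countSeq_nonneg L k K σ) _ _ _

end Count

variable [DecidableEq ι]

/-! ### Conditional distribution of a fresh value, by switching -/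

/-- The tuple in which the values `b` and `b'` of the letter `a` are interchanged. -/
def swapValues (a : ι × Bool) (b b' : α) (σ : ι → Perm α) : ι → Perm α :=
  Function.update σ a.1 (if a.2 then swap b b' * σ a.1 else σ a.1 * swap b b')

lemma evalLetter_swapValues (a : ι × Bool) (b b' : α) (σ : ι → Perm α) :
    evalLetter (swapValues a b b' σ) a = swap b b' * evalLetter σ a := by
  rcases a with ⟨i, _ | _⟩ <;> simp [evalLetter, swapValues]

lemma evalLetter_swapValues_of_ne {a c : ι × Bool} (b b' : α) (σ : ι → Perm α) (h : c.1 ≠ a.1) :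
    evalLetter (swapValues a b b' σ) c = evalLetter σ c := by
  simp [evalLetter, swapValues, h]

lemma swapValues_swapValues (a : ι × Bool) (b b' : α) (σ : ι → Perm α) :
    swapValues a b b' (swapValues a b b' σ) = σ := by
  funext j
  by_cases h : j = a.1
  · subst h
    rcases a with ⟨i, _ | _⟩ <;> simp [swapValues, mul_assoc, ← mul_assoc (swap b b')]
  · simp [swapValues, h]

variable [Fintype ι] [Fintype α]

/-- The tuples compatible with the revealed values. -/
def consistent (K : List ((ι × Bool) × α × α)) : Finset (ι → Perm α) :=
  univ.filter fun σ => ∀ q ∈ K, evalLetter σ q.1 q.2.1 = q.2.2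

lemma mem_consistent {K : List ((ι × Bool) × α × α)} {σ : ι → Perm α} :
    σ ∈ consistent K ↔ ∀ q ∈ K, evalLetter σ q.1 q.2.1 = q.2.2 := by
  simp [consistent]

lemma consistent_cons (a : ι × Bool) (y b : α) (K : List ((ι × Bool) × α × α)) :
    consistent ((a, y, b) :: K) = (consistent K).filter fun σ : ι → Perm α => evalLetter σ a y = b := by
  ext σ
  simp [mem_consistent, mem_filter, and_comm]

lemma sum_consistent_eq (K : List ((ι × Bool) × α × α)) (a : ι × Bool) (y : α)
    (F : (ι → Perm α) → ℝ) :
    ∑ σ ∈ consistent K, F σ = ∑ b, ∑ σ ∈ consistent ((a, y, b) :: K), F σ := by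
  simp_rw [consistent_cons]
  exact (Finset.sum_fiberwise _ _ _).symm

lemma swapValues_mem_consistent {K : List ((ι × Bool) × α × α)} {a : ι × Bool} {b b' : α}
    (hb : Fresh K (invLetter a) b) (hb' : Fresh K (invLetter a) b') {σ : ι → Perm α}
    (hσ : σ ∈ consistent K) : swapValues a b b' σ ∈ consistent K := by
  rw [mem_consistent] at *
  intro q hq
  have e := hσ q hq
  have h1 := hb q hq
  have h2 := hb' q hq
  by_cases h : q.1.1 = a.1
  · rcases eq_or_eq_invLetter h with h | h
    · rw [h, evalLetter_swapValues, Perm.mul_apply, ← h, e]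
      rw [invLetter_invLetter] at h1 h2
      exact swap_apply_of_ne_of_ne (h1.2 h) (h2.2 h)
    · rw [h, evalLetter_invLetter, evalLetter_swapValues, mul_inv_rev, swap_inv,
        Perm.mul_apply, swap_apply_of_ne_of_ne (h1.1 h) (h2.1 h), ← evalLetter_invLetter, ← h, e]
  · rw [evalLetter_swapValues_of_ne _ _ _ h, e]

/-- Interchanging two unused values is an involution respecting the revealed data, so all unused
values are equally likely. -/
lemma card_consistent_cons_le {K : List ((ι × Bool) × α × α)} {a : ι × Bool} {b b' y : α}
    (hb : Fresh K (invLetter a) b) (hb' : Fresh K (invLetter a) b') :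
    #(consistent ((a, y, b) :: K)) ≤ #(consistent ((a, y, b') :: K)) := by
  refine card_le_card_of_injOn (swapValues a b b') ?_ ?_
  · intro σ hσ
    simp only [consistent_cons, mem_coe, mem_filter] at hσ ⊢
    refine ⟨swapValues_mem_consistent hb hb' hσ.1, ?_⟩
    rw [evalLetter_swapValues, Perm.mul_apply, hσ.2, swap_apply_left]
  · intro σ _ τ _ h
    simpa [swapValues_swapValues] using congrArg (swapValues a b b') h

/-- Each value of a letter at a fresh point is taken with probability at most `1 / (n - |K|)`. -/
lemma card_consistent_cons_mul_le {K : List ((ι × Bool) × α × α)} {a : ι × Bool} {y : α}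
    (hy : Fresh K a y) (b : α) :
    (#(consistent ((a, y, b) :: K)) : ℝ) * (Fintype.card α - K.length) ≤ #(consistent K) := by
  classical
  by_cases hb : Fresh K (invLetter a) b
  · set S : Finset α := univ.filter fun b' => Fresh K (invLetter a) b' with hS
    have hcard : (Fintype.card α : ℝ) - K.length ≤ #S := by
      have : #Sᶜ ≤ K.length := by
        -- Each revealed triple rules out at most one value of `a`; triples of other variables are
        -- counted harmlessly.
        have hsub : Sᶜ ⊆ (K.map fun q => if q.1 = a then q.2.2 else q.2.1).toFinset := by
          intro x hx
          replace hx : ¬ Fresh K (invLetter a) x := by simpa [hS] using hx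
          simp only [Fresh, not_forall] at hx
          obtain ⟨q, hq, hx⟩ := hx
          rw [List.mem_toFinset, List.mem_map]
          refine ⟨q, hq, ?_⟩
          by_cases h : q.1 = a
          · have := invLetter_ne a
            rw [if_pos h]
            by_contra hne
            exact hx ⟨fun h' => absurd (h.symm.trans h') (Ne.symm this), fun _ => hne⟩
          · rw [if_neg h]
            by_contra hne
            rw [invLetter_invLetter] at hx
            exact hx ⟨fun _ => hne, fun h' => absurd h' h⟩
        exact (card_le_card hsub).trans ((List.toFinset_card_le _).trans (by simp))
      have h2 := card_add_card_compl S
      have : (#S : ℝ) + #Sᶜ = Fintype.card α := by exact_mod_cast h2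
      have : (#Sᶜ : ℝ) ≤ K.length := by exact_mod_cast ‹#Sᶜ ≤ K.length›
      linarith
    have h1 : (#S : ℝ) * #(consistent ((a, y, b) :: K)) ≤ #(consistent K) := by
      have e := sum_consistent_eq K a y fun _ => 1
      simp only [sum_const, nsmul_eq_mul, mul_one] at e
      rw [e, ← nsmul_eq_mul, ← sum_const]
      refine (sum_le_sum (f := fun _ => (#(consistent ((a, y, b) :: K)) : ℝ))
        (g := fun b' => (#(consistent ((a, y, b') :: K)) : ℝ)) ?_).trans ?_
      · intro b' hb'
        exact_mod_cast card_consistent_cons_le hb (by simpa [hS] using hb')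
      · exact sum_le_sum_of_subset_of_nonneg (subset_univ _) fun _ _ _ => by positivity
    calc _ ≤ (#(consistent ((a, y, b) :: K)) : ℝ) * #S := by gcongr
      _ ≤ _ := by rw [mul_comm]; exact h1
  -- Here the preimage of b under `a` is already revealed, and it is not y because y is fresh.
  · have : consistent ((a, y, b) :: K) = ∅ := by
      rw [eq_empty_iff_forall_notMem]
      intro σ hσ
      rw [consistent_cons, mem_filter, mem_consistent] at hσ
      apply hb
      intro q hq
      have h1 := hσ.1 q hq
      have h2 := hy q hq
      refine ⟨fun h e => h2.2 h ?_, fun h e => ?_⟩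
      · rw [← h1, h, e, evalLetter_invLetter, ← hσ.2]
        simp
      · rw [invLetter_invLetter] at h
        refine h2.1 h ((evalLetter σ a).injective ?_)
        rw [hσ.2, ← e, ← h1, h]
    rw [this]
    simp

/-- A union bound over the steps: each query is fresh, and at most 2m + 1 of its values produce a
coincidence, which costs a factor β per step. After the coincidence, `Φ` contributes on average at
most `A`. -/
lemma sum_walk_le {Φ : List ((ι × Bool) × α × α) → (ι → Perm α) → ℝ} {A β : ℝ} {m : ℕ}
    (hA : 0 ≤ A) (hm : m < Fintype.card α) (hβ : 2 * m + 1 ≤ β * (Fintype.card α - m))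
    (hΦ : ∀ K, K.length ≤ m → ∑ σ ∈ consistent K, Φ K σ ≤ A * #(consistent K))
    (L : List ((ι × Bool) × Perm α)) (hL : L.IsChain NoBacktrack)
    (K : List ((ι × Bool) × α × α)) (hK : K.length + L.length ≤ m) (y : α)
    (hy : ∀ s ∈ L.head?, Fresh K s.1 y) :
    ∑ σ ∈ consistent K, walk Φ σ L K y ≤ L.length * β * A * #(consistent K) := by
  have hmn : (0 : ℝ) < Fintype.card α - m := by
    have : (m : ℝ) < Fintype.card α := by exact_mod_cast hm
    linarith
  have hβ0 : 0 ≤ β := by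
    by_contra! h
    have := mul_neg_of_neg_of_pos h hmn
    have : (0 : ℝ) ≤ m := by positivity
    linarith
  induction L generalizing K y with
  | nil => simp [walk]
  | cons s L ih =>
    obtain ⟨a, d⟩ := s
    have hy' : Fresh K a y := hy (a, d) rfl
    rw [sum_consistent_eq K a y]
    simp only [List.length_cons] at hK
    have hKm : (K.length : ℝ) ≤ m := by exact_mod_cast (by omega : K.length ≤ m)
    set bad : Finset α := univ.filter fun b => d b ∈ insert y (touched K) with hbad
    have hbadcard : (#bad : ℝ) ≤ 2 * m + 1 := by
      have h1 : #bad ≤ #(insert y (touched K)) :=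
        card_le_card_of_injOn d (fun b hb => by simpa [hbad] using hb) d.injective.injOn
      have h2 := (card_insert_le y (touched K)).trans
        (Nat.add_le_add_right (card_touched_le K) 1)
      have : (#bad : ℝ) ≤ 2 * K.length + 1 := by exact_mod_cast h1.trans h2
      linarith
    have hterm : ∀ b, ∑ σ ∈ consistent ((a, y, b) :: K), walk Φ σ ((a, d) :: L) K y ≤
        (if b ∈ bad then A * #(consistent ((a, y, b) :: K)) else 0) +
          L.length * β * A * #(consistent ((a, y, b) :: K)) := by
      intro b
      have hval : ∀ σ ∈ consistent ((a, y, b) :: K), evalLetter σ a y = b := by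
        intro σ hσ
        rw [consistent_cons, mem_filter] at hσ
        exact hσ.2
      by_cases hb : b ∈ bad
      · rw [if_pos hb]
        have hb' : d b ∈ insert y (touched K) := by simpa [hbad] using hb
        have : ∑ σ ∈ consistent ((a, y, b) :: K), walk Φ σ ((a, d) :: L) K y =
            ∑ σ ∈ consistent ((a, y, b) :: K), Φ ((a, y, b) :: K) σ := by
          refine sum_congr rfl fun σ hσ => ?_
          rw [walk]
          simp only [hval σ hσ, if_pos hb']
        rw [this]
        have h1 := hΦ ((a, y, b) :: K) (by simp; omega)
        have : 0 ≤ L.length * β * A * #(consistent ((a, y, b) :: K)) := by positivity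
        linarith
      · rw [if_neg hb, zero_add]
        have hb' : d b ∉ insert y (touched K) := by simpa [hbad] using hb
        have : ∑ σ ∈ consistent ((a, y, b) :: K), walk Φ σ ((a, d) :: L) K y =
            ∑ σ ∈ consistent ((a, y, b) :: K), walk Φ σ L ((a, y, b) :: K) (d b) := by
          refine sum_congr rfl fun σ hσ => ?_
          rw [walk]
          simp only [hval σ hσ, if_neg hb']
        rw [this]
        refine ih hL.tail _ (by simp; omega) _ ?_
        intro t ht
        -- The new point avoids y and the touched points, so only the triple just added could reveal
        -- its next value. That would need an inverse letter and d b = b, which `NoBacktrack`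
        -- excludes.
        rw [mem_insert, not_or] at hb'
        intro q hq
        rcases List.mem_cons.1 hq with rfl | hq
        · refine ⟨fun _ e => hb'.1 e.symm, fun e1 e2 => ?_⟩
          cases L with
          | nil => simp at ht
          | cons t' L =>
            simp only [List.head?_cons, Option.mem_def, Option.some.injEq] at ht
            subst ht
            rw [List.isChain_cons_cons] at hL
            refine hL.1 ?_ b e2.symm
            rw [e1]; simp
        · exact fresh_of_notMem_touched hb'.2 t.1 q hq
    refine (sum_le_sum fun b _ => hterm b).trans ?_
    rw [sum_add_distrib, ← sum_filter, ← mul_sum]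
    have hN : ∑ b, (#(consistent ((a, y, b) :: K)) : ℝ) = #(consistent K) := by
      have e := sum_consistent_eq K a y fun _ => 1
      simpa only [sum_const, nsmul_eq_mul, mul_one] using e.symm
    rw [← mul_sum, hN, filter_mem_eq_inter, univ_inter]
    have key : ∑ b ∈ bad, (#(consistent ((a, y, b) :: K)) : ℝ) ≤ β * #(consistent K) := by
      have h1 : (∑ b ∈ bad, (#(consistent ((a, y, b) :: K)) : ℝ)) * (Fintype.card α - m) ≤
          β * #(consistent K) * (Fintype.card α - m) := by
        rw [sum_mul]
        calc _ ≤ ∑ b ∈ bad, (#(consistent K) : ℝ) := by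
              refine sum_le_sum fun b _ => ?_
              refine le_trans ?_ (card_consistent_cons_mul_le hy' b)
              gcongr
          _ = #bad * #(consistent K) := by simp
          _ ≤ (β * (Fintype.card α - m)) * #(consistent K) := by
              gcongr
              linarith
          _ = _ := by ring
      exact le_of_mul_le_mul_right h1 hmn
    have := mul_le_mul_of_nonneg_left key hA
    push_cast [List.length_cons]
    linarith

/-- Each round has at most n starting points, each succeeding with conditional probability at most
`L.length * β`; the rounds multiply. -/
lemma sum_countSeq_le {β : ℝ} {m : ℕ} (hm : m < Fintype.card α) (hβ0 : 0 ≤ β)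
    (hβ : 2 * m + 1 ≤ β * (Fintype.card α - m))
    (L : List ((ι × Bool) × Perm α)) (hL : L.IsChain NoBacktrack) (k : ℕ)
    (K : List ((ι × Bool) × α × α)) (hK : K.length + k * L.length ≤ m) :
    ∑ σ ∈ consistent K, countSeq L k K σ ≤
      (Fintype.card α * (L.length * β)) ^ k * #(consistent K) := by
  induction k generalizing K with
  | zero => simp [countSeq]
  | succ k ih =>
    simp only [countSeq]
    rw [sum_comm]
    have hle : k * L.length + L.length ≤ m := by rw [Nat.succ_mul] at hK; omega
    have hcast : ((m - k * L.length : ℕ) : ℝ) ≤ m := by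
      exact_mod_cast Nat.sub_le _ _
    have hstep : ∀ y ∈ (touched K)ᶜ, ∑ σ ∈ consistent K, walk (countSeq L k) σ L K y ≤
        L.length * β * (Fintype.card α * (L.length * β)) ^ k * #(consistent K) := by
      intro y hy
      -- The budget of this walk leaves room for the k rounds that follow.
      refine sum_walk_le (m := m - k * L.length) (by positivity) (by omega) ?_ ?_ L hL K ?_ y ?_
      · have := mul_le_mul_of_nonneg_left hcast hβ0
        linarith
      · intro K' hK'
        exact ih K' (by omega)
      · rw [Nat.succ_mul] at hK; omega
      · intro s _
        exact fresh_of_notMem_touched (mem_compl.1 hy) s.1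
    refine (sum_le_sum hstep).trans ?_
    rw [sum_const, nsmul_eq_mul]
    have : (#(touched K)ᶜ : ℝ) ≤ Fintype.card α := by exact_mod_cast card_le_univ _
    calc _ ≤ (Fintype.card α : ℝ) *
          (L.length * β * (Fintype.card α * (L.length * β)) ^ k * #(consistent K)) := by gcongr
      _ = _ := by ring

end Exposure

/-! ### Cyclic reduction and evaluation of regular words -/

section Words

/-- If a syllable `(a, c)` is followed by the inverse of `a`, then the constant `c` satisfies `P`. -/
def CriticalSat {ι G : Type*} (P : G → Prop) (s t : (ι × Bool) × G) : Prop :=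
  t.1 = invLetter s.1 → P s.2

lemma isChain_criticalSat_concat_iff {ι G : Type*} {P : G → Prop} (L : List ((ι × Bool) × G))
    (a : ι × Bool) (c d : G) :
    (L ++ [(a, c)]).IsChain (CriticalSat P) ↔ (L ++ [(a, d)]).IsChain (CriticalSat P) := by
  simp [List.isChain_append, CriticalSat]

namespace ConstWord

variable {G : Type*} {r : ℕ}

lemma forall_criticalConstants_iff (w : ConstWord G r) (P : G → Prop) :
    (∀ c ∈ w.criticalConstants, P c) ↔ w.syllables.IsChain (CriticalSat P) := by
  rw [List.isChain_iff_forall_rel_of_append_cons_cons]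
  constructor
  · rintro h ⟨⟨i, e⟩, c⟩ ⟨b, d⟩ p s hw hb
    exact h c ⟨i, e, d, p, s, by rw [hw]; simp only at hb; rw [hb]; rfl⟩
  · rintro h c ⟨i, e, d, p, s, hw⟩
    exact h hw rfl

variable [Group G]

/-- The element of the free product represented by a list of syllables. -/
def syllableProd (L : List ((Fin r × Bool) × G)) : Coprod G (FreeGroup (Fin r)) :=
  (L.map fun a => Coprod.inr (letter a.1) * Coprod.inl a.2).prod

lemma toCoprod_mk (f : G) (L : List ((Fin r × Bool) × G)) :
    toCoprod ⟨f, L⟩ = Coprod.inl f * syllableProd L := rfl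

@[simp] lemma syllableProd_nil :
    syllableProd ([] : List ((Fin r × Bool) × G)) = 1 := rfl

lemma syllableProd_cons (s : (Fin r × Bool) × G) (L : List ((Fin r × Bool) × G)) :
    syllableProd (s :: L) = Coprod.inr (letter s.1) * Coprod.inl s.2 * syllableProd L := by
  simp [syllableProd]

lemma syllableProd_append (L M : List ((Fin r × Bool) × G)) :
    syllableProd (L ++ M) = syllableProd L * syllableProd M := by
  simp [syllableProd]

lemma syllableProd_singleton (s : (Fin r × Bool) × G) :
    syllableProd [s] = Coprod.inr (letter s.1) * Coprod.inl s.2 := by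
  simp [syllableProd]

lemma letter_invLetter (a : Fin r × Bool) : letter (invLetter a) = (letter a)⁻¹ := by
  rcases a with ⟨i, _ | _⟩ <;> simp [letter, invLetter]

/-- A reduced expression that is not conjugate to a constant is conjugate to a list of syllables `C`
whose cyclic critical constants are among the critical constants of a reduced expression of its
square. -/
lemma exists_cyclic_core (L : List ((Fin r × Bool) × G)) (f : G)
    (hL : L.IsChain (CriticalSat (· ≠ 1)))
    (hconj : ¬ ∃ g : G, IsConj (toCoprod ⟨f, L⟩) (Coprod.inl g)) :
    ∃ C V : List ((Fin r × Bool) × G), C ≠ [] ∧ C.length ≤ L.length ∧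
      IsConj (toCoprod ⟨f, L⟩) (syllableProd C) ∧
      V.IsChain (CriticalSat (· ≠ 1)) ∧ toCoprod ⟨f, V⟩ = toCoprod ⟨f, L⟩ ^ 2 ∧
      (∀ P : G → Prop, V.IsChain (CriticalSat P) → (C ++ C).IsChain (CriticalSat P)) ∧
      V.head?.map Prod.fst = L.head?.map Prod.fst ∧ V.getLast? = L.getLast? := by
  induction hN : L.length using Nat.strong_induction_on generalizing L f with
  | _ N ih =>
  subst hN
  rcases List.eq_nil_or_concat' L with rfl | ⟨S, ⟨a, c⟩, rfl⟩
  · refine absurd ⟨f, ?_⟩ hconj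
    rw [toCoprod_mk, syllableProd_nil, mul_one]
  -- In the square, the last and first constants merge to c * f. If nothing cancels there, the word
  -- is already cyclically reduced.
  by_cases hV : ((S ++ [(a, c * f)]) ++ (S ++ [(a, c)])).IsChain (CriticalSat (· ≠ 1))
  · refine ⟨S ++ [(a, c * f)], _, by simp, by simp, ?_, hV, ?_, ?_, ?_, ?_⟩
    · rw [isConj_iff]
      refine ⟨(Coprod.inl f)⁻¹, ?_⟩
      simp [toCoprod_mk, syllableProd_append, syllableProd_singleton, mul_assoc]
    · simp [toCoprod_mk, syllableProd_append, syllableProd_cons, mul_assoc, pow_two]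
    -- The final constant is never critical, so it may be changed from c to c * f.
    · intro P h
      rw [← List.append_assoc] at h ⊢
      exact (isChain_criticalSat_concat_iff _ _ _ _).1 h
    · cases S <;> simp
    · rw [← List.append_assoc, List.getLast?_concat, List.getLast?_concat]
  -- Otherwise c * f = 1 between inverse letters: the word is a conjugate of one shorter by two
  -- letters, and induction applies.
  · rw [List.isChain_append] at hV
    have h1 := (isChain_criticalSat_concat_iff (P := (· ≠ 1)) S a c (c * f)).1 hL
    simp only [h1, hL, true_and, not_forall, CriticalSat, not_not, List.getLast?_append,
      List.getLast?_singleton, Option.some_or, Option.mem_def, Option.some.injEq] at hV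
    obtain ⟨_, rfl, t, ht, hta, hcf⟩ := hV
    simp only at hta hcf
    obtain rfl : c = f⁻¹ := eq_inv_of_mul_eq_one_left hcf
    cases S with
    | nil =>
      simp only [List.nil_append, List.head?_cons, Option.some.injEq] at ht
      subst ht
      exact absurd hta.symm (invLetter_ne a)
    | cons t' M =>
    simp only [List.cons_append, List.head?_cons, Option.some.injEq] at ht
    subst ht
    obtain ⟨b, c₁⟩ := t'
    simp only at hta
    subst hta
    set g : Coprod G (FreeGroup (Fin r)) := Coprod.inl f * Coprod.inr (letter (invLetter a)) with hg
    have hw : toCoprod ⟨f, (invLetter a, c₁) :: M ++ [(a, f⁻¹)]⟩ = g * toCoprod ⟨c₁, M⟩ * g⁻¹ := by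
      simp [toCoprod_mk, syllableProd_append, syllableProd_cons, mul_assoc,
        letter_invLetter, hg]
    have hw' : IsConj (toCoprod ⟨f, (invLetter a, c₁) :: M ++ [(a, f⁻¹)]⟩)
        (toCoprod ⟨c₁, M⟩) := (isConj_iff.2 ⟨g, hw.symm⟩).symm
    have hne : M ≠ [] := by
      rintro rfl
      exact hconj ⟨c₁, by simpa [toCoprod_mk, syllableProd] using hw'⟩
    rw [List.cons_append, List.isChain_cons] at hL
    obtain ⟨C, V, hC, hlen, hCc, hVr, hVsq, hVC, hVh, hVl⟩ := ih M.length (by simp) M c₁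
      (List.isChain_append.1 hL.2).1 (fun ⟨d, hd⟩ => hconj ⟨d, hw'.trans hd⟩) rfl
    refine ⟨C, (invLetter a, c₁) :: V ++ [(a, f⁻¹)], hC,
      by simpa using hlen.trans (Nat.le_add_right _ 2), hw'.trans hCc, ?_, ?_, ?_,
      by simp, by rw [List.getLast?_concat, List.getLast?_concat]⟩
    · rw [List.cons_append, List.isChain_cons]
      -- V begins with the same letter and ends with the same syllable as M, so both new joints are
      -- reduced because those of the original word are.
      refine ⟨?_, List.isChain_append.2 ⟨hVr, by simp, ?_⟩⟩
      · cases M with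
        | nil => exact absurd rfl hne
        | cons t M =>
        cases V with
        | nil => simp at hVh
        | cons t' V =>
        simp only [List.head?_cons, Option.map_some, Option.some.injEq] at hVh
        simpa [CriticalSat, hVh] using hL.1
      · rw [hVl]
        exact (List.isChain_append.1 hL.2).2.2
    · have : toCoprod ⟨f, (invLetter a, c₁) :: V ++ [(a, f⁻¹)]⟩ = g * toCoprod ⟨c₁, V⟩ * g⁻¹ := by
        simp [toCoprod_mk, syllableProd_append, syllableProd_cons,
          mul_assoc, letter_invLetter, hg]
      rw [this, hw, hVsq, pow_two, pow_two]
      group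
    · intro P hP
      rw [List.cons_append, List.isChain_cons] at hP
      exact hVC P (List.isChain_append.1 hP.2).1

lemma wordMap_inr_letter (σ : Fin r → G) (a : Fin r × Bool) :
    wordMap (Coprod.inr (letter a)) σ = evalLetter σ a := by
  rcases a with ⟨i, _ | _⟩ <;> simp [wordMap, letter, evalLetter]

lemma wordMap_syllableProd (σ : Fin r → G) (L : List ((Fin r × Bool) × G)) :
    wordMap (syllableProd L) σ = (L.map fun s => evalLetter σ s.1 * s.2).prod := by
  induction L with
  | nil => simp [wordMap, syllableProd]
  | cons s L ih =>
    rw [syllableProd_cons, List.map_cons, List.prod_cons, ← ih, ← wordMap_inr_letter]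
    simp [wordMap]

end ConstWord

/-- The inverse of a product of syllables, read as a list of steps. -/
def stepsOf {ι α : Type*} (C : List ((ι × Bool) × Equiv.Perm α)) :
    List ((ι × Bool) × Equiv.Perm α) :=
  C.map fun s => (invLetter s.1, s.2⁻¹)

/-- Permutations compose from right to left, so the inverse undoes the leftmost syllable first,
letter before constant, in the order of the list. Inversion does not affect cycle lengths. -/
lemma position_stepsOf {ι α : Type*} (σ : ι → Equiv.Perm α)
    (C : List ((ι × Bool) × Equiv.Perm α)) (y : α) :
    position σ (stepsOf C) y = (C.map fun s => evalLetter σ s.1 * s.2).prod⁻¹ y := by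
  induction C generalizing y with
  | nil => rfl
  | cons s C ih =>
    rw [stepsOf, List.map_cons, position, ← stepsOf, ih]
    simp

lemma position_flatten_replicate {ι α : Type*} (σ : ι → Equiv.Perm α)
    (L : List ((ι × Bool) × Equiv.Perm α)) (τ : Equiv.Perm α)
    (h : ∀ y, position σ L y = τ y) (k : ℕ) (y : α) :
    position σ (List.replicate k L).flatten y = (τ ^ k) y := by
  induction k generalizing y with
  | zero => rfl
  | succ k ih => rw [List.replicate_succ, List.flatten_cons, position_append, ih, h, pow_succ,
      Equiv.Perm.mul_apply]

lemma isChain_flatten_replicate {β : Type*} {R : β → β → Prop} {L : List β}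
    (h : (L ++ L).IsChain R) (k : ℕ) : (List.replicate k L).flatten.IsChain R := by
  rw [List.isChain_append] at h
  induction k with
  | zero => simp
  | succ k ih =>
    rw [List.replicate_succ, List.flatten_cons, List.isChain_append]
    refine ⟨h.1, ih, fun x hx y hy => h.2.2 x hx y ?_⟩
    cases k with
    | zero => simp at hy
    | succ k =>
      cases L with
      | nil => simp at hx
      | cons t L => simpa [List.replicate_succ] using hy

/-- For a regular word, the values are up to conjugation and inversion given by a list of steps that
is cyclically without backtracking. -/
lemma exists_steps_of_isRegularWord {n r : ℕ} {w : ConstWord (Equiv.Perm (Fin n)) r}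
    (hw : w.IsReduced) (hreg : IsRegularWord w.toCoprod) :
    ∃ L : List ((Fin r × Bool) × Equiv.Perm (Fin n)), L ≠ [] ∧ L.length ≤ w.length ∧
      (L ++ L).IsChain NoBacktrack ∧
      ∀ σ, ∃ τ, IsConj (wordMap w.toCoprod σ) τ ∧ ∀ y, position σ L y = τ⁻¹ y := by
  obtain ⟨C, V, hC, hlen, hconj, hVr, hVsq, hVC, -, -⟩ :=
    ConstWord.exists_cyclic_core w.syllables w.first
      ((w.forall_criticalConstants_iff _).1 hw) hreg.1
  have hfpf := hVC _ ((ConstWord.forall_criticalConstants_iff ⟨w.first, V⟩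
    (fun c => ∀ x, c x ≠ x)).1 (hreg.2 ⟨w.first, V⟩
      ((ConstWord.forall_criticalConstants_iff ⟨w.first, V⟩ _).2 hVr) hVsq))
  refine ⟨stepsOf C, by simpa [stepsOf] using hC, by simpa [stepsOf, ConstWord.length] using hlen, ?_, fun σ =>
    ⟨_, ?_, position_stepsOf σ C⟩⟩
  · rw [stepsOf, ← List.map_append]
    refine List.isChain_map_of_isChain _ ?_ hfpf
    intro s t h e x hx
    refine h ?_ x ?_
    · simpa using congrArg invLetter e
    · exact (Equiv.Perm.inv_eq_iff_eq.1 hx).symm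
  · rw [← ConstWord.wordMap_syllableProd]
    exact (Coprod.lift (MonoidHom.id _) (FreeGroup.lift σ)).map_isConj hconj

lemma ncard_shortCyclePoints_of_isConj {n : ℕ} {σ τ : Equiv.Perm (Fin n)} (h : IsConj σ τ)
    (t : ℝ) : (shortCyclePoints σ t).ncard = (shortCyclePoints τ t).ncard := by
  obtain ⟨g, rfl⟩ := isConj_iff.1 h
  have hper : ∀ x, Function.minimalPeriod (g * σ * g⁻¹ : Equiv.Perm (Fin n)) (g x) =
      Function.minimalPeriod σ x := by
    intro x
    rw [Function.minimalPeriod_eq_minimalPeriod_iff]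
    intro k
    rw [Function.IsPeriodicPt, Function.IsPeriodicPt, Function.IsFixedPt, Function.IsFixedPt,
      ← Equiv.Perm.coe_pow, ← Equiv.Perm.coe_pow, conj_pow]
    simp
  rw [← Set.ncard_image_of_injective _ g.injective]
  congr 1
  ext y
  obtain ⟨x, rfl⟩ := g.surjective y
  rw [g.injective.mem_set_image]
  unfold shortCyclePoints cyclePoints
  simp only [Set.mem_ofPred_eq, hper]

end Words

/-! ### Markov's inequality and the choice of parameters -/

lemma card_mul_pow_le {n r : ℕ} {L : List ((Fin r × Bool) × Equiv.Perm (Fin n))}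
    (hL : L.IsChain NoBacktrack) {β f : ℝ} {m k : ℕ} (hm : m < n) (hβ0 : 0 ≤ β)
    (hβ : 2 * m + 1 ≤ β * (n - m)) (hk : k * L.length ≤ m) (hf : 2 * m ≤ f)
    (E : Finset (Fin r → Equiv.Perm (Fin n)))
    (hE : ∀ σ ∈ E, ∃ S : Finset (Fin n), f ≤ S.card ∧
      ∀ y ∈ S, ∃ L₁ L₂, L = L₁ ++ L₂ ∧ L₁ ≠ [] ∧ position σ L₁ y = y) :
    (E.card : ℝ) * (f - 2 * m) ^ k ≤
      (n * (L.length * β)) ^ k * Nat.card (Fin r → Equiv.Perm (Fin n)) := by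
  have h := sum_countSeq_le (α := Fin n) (ι := Fin r) (by simpa using hm) hβ0 (by simpa using hβ)
    L hL k [] (by simpa using hk)
  have huniv : consistent ([] : List ((Fin r × Bool) × Fin n × Fin n)) = Finset.univ := by
    ext; simp [mem_consistent]
  rw [huniv, Finset.card_univ, Fintype.card_fin] at h
  rw [Nat.card_eq_fintype_card]
  refine le_trans ?_ h
  rw [← nsmul_eq_mul, ← Finset.sum_const]
  refine (Finset.sum_le_sum (g := countSeq L k []) fun σ hσ => ?_).trans
    (Finset.sum_le_sum_of_subset_of_nonneg (Finset.subset_univ _)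
      fun σ _ _ => countSeq_nonneg L k [] σ)
  obtain ⟨S, hfS, hS⟩ := hE σ hσ
  exact pow_le_countSeq hf S hfS hS k [] (by simpa using hk)

/-- A point in a short cycle of `τ` returns to itself when the steps that evaluate to `τ⁻¹` are
repeated. -/
lemma exists_position_eq_of_mem_shortCyclePoints {n r : ℕ}
    {L : List ((Fin r × Bool) × Equiv.Perm (Fin n))} (hL : L ≠ [])
    {σ : Fin r → Equiv.Perm (Fin n)} {τ : Equiv.Perm (Fin n)}
    (hτ : ∀ y, position σ L y = τ⁻¹ y) {h : ℝ} {y : Fin n} (hy : y ∈ shortCyclePoints τ h) :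
    ∃ L₁ L₂, (List.replicate ⌊h⌋₊ L).flatten = L₁ ++ L₂ ∧ L₁ ≠ [] ∧ position σ L₁ y = y := by
  obtain ⟨i, hi, hih, hyi⟩ := hy
  have hle : i ≤ ⌊h⌋₊ := Nat.le_floor hih
  refine ⟨(List.replicate i L).flatten, (List.replicate (⌊h⌋₊ - i) L).flatten, ?_, ?_, ?_⟩
  · rw [← List.flatten_append, List.replicate_append_replicate, Nat.add_sub_cancel' hle]
  · obtain ⟨j, rfl⟩ := Nat.exists_eq_add_of_le' hi
    simp [List.replicate_succ, hL]
  · rw [position_flatten_replicate σ L _ hτ, inv_pow, Equiv.Perm.inv_eq_iff_eq,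
      Equiv.Perm.coe_pow]
    have := Function.iterate_minimalPeriod (f := τ) (x := y)
    rw [show Function.minimalPeriod τ y = i from hyi] at this
    exact this.symm

lemma uniformProb_eq_zero_of_forall_notMem {β : Type*} [Finite β] {A : Set β}
    (h : ∀ x, x ∉ A) : uniformProb A = 0 := by
  rw [Set.eq_empty_of_forall_notMem h]
  simp [uniformProb]

theorem proposition2p3 :
    ∃ c : ℝ, 0 < c ∧
      ∀ f h : ℝ, 0 ≤ f → 0 < h →
        ∀ (n r : ℕ) (w : ConstWord (Equiv.Perm (Fin n)) r),
          w.IsReduced → IsRegularWord w.toCoprod →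
          (w.length : ℝ) < c * Real.sqrt f / h →
          uniformProb {σ : Fin r → Equiv.Perm (Fin n) |
              f ≤ ((shortCyclePoints (wordMap w.toCoprod σ) h).ncard : ℝ)} ≤
            Real.exp (-(c * f / ((w.length : ℝ) * h) ^ 2)) := by
  classical
  refine ⟨1 / 48, by norm_num, ?_⟩
  intro f h hf0 hh n r w hw hreg hlen
  obtain ⟨L, hLne, hLlen, hchain, hτ⟩ := exists_steps_of_isRegularWord hw hreg
  have hLpos : 1 ≤ L.length := List.length_pos_iff.2 hLne
  have hDlt : (w.length : ℝ) * h < 1 / 48 * Real.sqrt f := (lt_div_iff₀ hh).1 hlen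
  set D : ℝ := (w.length : ℝ) * h with hD
  have hl1 : (1 : ℝ) ≤ w.length := by exact_mod_cast hLpos.trans hLlen
  have hD0 : 0 < D := by positivity
  have hDf : 2304 * D ^ 2 < f := by
    have h1 : (48 * D) ^ 2 < Real.sqrt f ^ 2 := by gcongr; linarith
    rw [Real.sq_sqrt hf0] at h1
    linarith
  have hfpos : 0 < f := lt_trans (by positivity) hDf
  -- If h < 1 or f > n, the event is empty.
  rcases lt_or_ge h 1 with hh1 | hh1
  · rw [uniformProb_eq_zero_of_forall_notMem]
    · positivity
    intro σ hσ
    have : shortCyclePoints (wordMap w.toCoprod σ) h = ∅ := by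
      refine Set.eq_empty_of_forall_notMem ?_
      rintro y ⟨i, hi, hih, -⟩
      have : (1 : ℝ) ≤ i := by exact_mod_cast hi
      linarith
    rw [Set.mem_ofPred_eq, this, Set.ncard_empty] at hσ
    norm_num at hσ
    linarith
  rcases lt_or_ge (n : ℝ) f with hnf | hnf
  · rw [uniformProb_eq_zero_of_forall_notMem]
    · positivity
    intro σ hσ
    have h2 : (shortCyclePoints (wordMap w.toCoprod σ) h).ncard ≤ n := by
      simpa using Set.ncard_le_ncard (Set.subset_univ (shortCyclePoints (wordMap w.toCoprod σ) h))
    have h3 : ((shortCyclePoints (wordMap w.toCoprod σ) h).ncard : ℝ) ≤ n := by exact_mod_cast h2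
    exact absurd (hσ.trans h3) (not_le.2 hnf)
  set M := (List.replicate ⌊h⌋₊ L).flatten with hM
  have hD1 : 1 ≤ D := by nlinarith
  have hT1 : 1 ≤ M.length := by
    have : 1 ≤ ⌊h⌋₊ := Nat.le_floor (by simpa using hh1)
    simpa [hM] using Nat.mul_le_mul this hLpos
  have hTD : (M.length : ℝ) ≤ D := by
    have h1 : (⌊h⌋₊ : ℝ) ≤ h := Nat.floor_le hh.le
    have h2 : (L.length : ℝ) ≤ w.length := by exact_mod_cast hLlen
    calc (M.length : ℝ) = ⌊h⌋₊ * L.length := by simp [hM]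
      _ ≤ h * w.length := by gcongr
      _ = D := mul_comm _ _
  -- With about x rounds of at most D steps, both m and m * T are at most f / 24, where T =
  -- `M.length`.
  set x : ℝ := f / (24 * D ^ 2) with hx
  have hx2 : 2 ≤ x := by
    rw [hx, le_div_iff₀ (by positivity)]
    nlinarith
  set t := ⌊x⌋₊ with ht
  have htx : (t : ℝ) ≤ x := Nat.floor_le (by linarith)
  have hxt : x < t + 1 := Nat.lt_floor_add_one x
  have hxD : x * D ^ 2 = f / 24 := by rw [hx]; field_simp
  set m := t * M.length with hm
  have hmcast : (m : ℝ) = t * M.length := by rw [hm]; push_cast; ring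
  have hm24 : (m : ℝ) ≤ f / 24 := by
    rw [hmcast, ← hxD, pow_two]
    have : D ≤ D * D := by nlinarith
    gcongr
    linarith
  have hmT : (m : ℝ) * M.length ≤ f / 24 := by
    rw [hmcast, ← hxD, pow_two, mul_assoc]
    gcongr
  have hm1 : (1 : ℝ) ≤ m := by
    have h1 : 1 ≤ t := Nat.le_floor (by push_cast; linarith)
    exact_mod_cast Nat.mul_le_mul h1 hT1
  have hnm : (0 : ℝ) < n - m := by linarith
  set β : ℝ := (2 * m + 1) / (n - m) with hβ
  have hβ0 : 0 ≤ β := by positivity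
  have hβmul : β * (n - m) = 2 * m + 1 := div_mul_cancel₀ _ hnm.ne'
  -- Uses 2m + 1 ≤ 3m and m ≤ f / 24 ≤ n / 24.
  have hnβ : n * β ≤ 4 * m := by nlinarith
  -- The left side is at most 4mT ≤ f / 6, while f - 2m ≥ 11f / 12 and 1/e ≥ 1/3.
  have hbound : (n : ℝ) * (M.length * β) ≤ (f - 2 * m) * Real.exp (-1) := by
    have he : (1 / 3 : ℝ) ≤ Real.exp (-1) := by
      rw [Real.exp_neg, ← one_div]
      have := Real.exp_one_lt_d9
      exact one_div_le_one_div_of_le (Real.exp_pos _) (by linarith)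
    calc (n : ℝ) * (M.length * β) = n * β * M.length := by ring
      _ ≤ 4 * m * M.length := by gcongr
      _ ≤ (f - 2 * m) * (1 / 3) := by linarith
      _ ≤ _ := by
        gcongr
        linarith
  set A := {σ : Fin r → Equiv.Perm (Fin n) |
    f ≤ ((shortCyclePoints (wordMap w.toCoprod σ) h).ncard : ℝ)} with hA
  have hcount := card_mul_pow_le (L := M) (isChain_flatten_replicate hchain _)
    (f := f) (m := m) (k := t) (by
      have : (m : ℝ) < n := by linarith
      exact_mod_cast this) hβ0 hβmul.ge hm.ge (by linarith) A.toFinset (by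
    intro σ hσ
    obtain ⟨τ, hconj, hpos⟩ := hτ σ
    refine ⟨(shortCyclePoints τ h).toFinset, ?_, ?_⟩
    · rw [← Set.ncard_eq_toFinset_card', ← ncard_shortCyclePoints_of_isConj hconj]
      simpa [hA] using hσ
    · intro y hy
      exact exists_position_eq_of_mem_shortCyclePoints hLne hpos (by simpa using hy))
  rw [← Set.ncard_eq_toFinset_card'] at hcount
  have hcard : (0 : ℝ) < Nat.card (Fin r → Equiv.Perm (Fin n)) := by
    exact_mod_cast Nat.card_pos
  have hf2 : 0 < f - 2 * m := by linarith
  have hmain : (A.ncard : ℝ) ≤ Real.exp (-1) ^ t * Nat.card (Fin r → Equiv.Perm (Fin n)) := by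
    refine le_of_mul_le_mul_right (hcount.trans ?_) (pow_pos hf2 t)
    calc _ ≤ ((f - 2 * m) * Real.exp (-1)) ^ t * Nat.card (Fin r → Equiv.Perm (Fin n)) := by
          gcongr
      _ = _ := by rw [mul_pow]; ring
  rw [uniformProb, div_le_iff₀ hcard]
  refine hmain.trans ?_
  gcongr
  rw [← Real.exp_nat_mul, Real.exp_le_exp]
  -- Rounding down costs at most a factor 2, since t > x - 1 ≥ x / 2 for x ≥ 2; hence 48 = 2 · 24.
  have : 1 / 48 * f / D ^ 2 = x / 2 := by rw [hx]; field_simp; norm_num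
  rw [this]
  linarith
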